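/- For $n\ge 1$ let $|\mathrm{GHZ}_n\rangle=\frac{1}{\sqrt2}(|0\rangle^{\otimes n}+|1\rangle^{\otimes n})\in(\mathbb{C}^2)^{\otimes n}$ and $\mathrm{GHZ}_n=|\mathrm{GHZ}_n\rangle\langle\mathrm{GHZ}_n|$. For $p\in[0,1]$ let $\rho(p)=p\,\phi^++\frac{1-p}{4}\mathbb{1}$ be the two-qubit isotropic state of visibility $p$, where $\phi^+$ is the projector onto $\frac{1}{\sqrt2}(|00\rangle+|11\rangle)$, and let $\mathcal{T}_p(\rho)=\mathcal{T}(\rho\otimes\rho(p))$ be the noisy teleportation channel, where $\mathcal{T}$ is the standard qubit teleportation protocol (Bell measurement on the first two qubits, followed by the corresponding Pauli correction on the third). Thus $(\mathcal{T}_p)^{\otimes n}(\mathrm{GHZ}_n)$ is the $n$-qubit state that arises when the centre of a star network with $n$ isotropic links of visibility $p$ teleports one share of a GHZ state to each of the other $n$ parties. An $n$-qubit state $\rho$, with one qubit held by each of $n$ parties, is called GHZ-distillable if there are $n$-partite LOCC maps $\Lambda_k$ ($k\in\mathbb{N}$), taking $k$ copies of the $n$-qubit system to one $n$-qubit system, such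 that $$\lim_{k\to\infty}F\bigl(\Lambda_k(\rho^{\otimes k}),\mathrm{GHZ}_n\bigr)=1,\qquad F(\rho,\sigma)=\Bigl(\operatorname{tr}\sqrt{\sqrt\rho\,\sigma\sqrt\rho}\Bigr)^2 .$$ Here LOCC maps are the maps implemented by finite-round protocols of local quantum operations and classical communication, together with all limits of such maps. **Theorem.** For every $p\in[0,1)$ there exists $n_0\in\mathbb{N}$ such that for all $n\ge n_0$ the state $(\mathcal{T}_p)^{\otimes n}(\mathrm{GHZ}_n)$ is not GHZ-distillable. -/

import Mathlib

namespace GHZNetwork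

noncomputable section

open scoped Kronecker MatrixOrder ComplexOrder

/-- Operators on the finite-dimensional Hilbert space with canonical basis indexed by `a`. -/
abbrev Op (a : Type) : Type := Matrix a a ℂ

/-- The rank-one operator `|v⟩⟨v|`. -/
def ketbra {a : Type} (v : a → ℂ) : Op a := Matrix.vecMulVec v (star v)

/-- The fidelity `F(ρ, σ) = (tr √(√ρ σ √ρ))²`. -/
def fidelity {a : Type} [Fintype a] [DecidableEq a] (ρ σ : Op a) : ℝ :=
  (Matrix.trace (CFC.sqrt (CFC.sqrt ρ * σ * CFC.sqrt ρ))).re ^ 2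

/-! ### Quantum operations -/

section Operations

variable {a b : Type} [Fintype a]

/-- The linear map `X ↦ ∑ y, K y * X * (K y)†`. -/
def krausMap {κ : Type} [Fintype κ] (K : κ → Matrix b a ℂ) : Op a →ₗ[ℂ] Op b where
  toFun X := ∑ y, K y * X * (K y).conjTranspose
  map_add' X Y := by simp [Matrix.mul_add, Matrix.add_mul, Finset.sum_add_distrib]
  map_smul' c X := by simp [Finset.smul_sum]

/-- Complete positivity, in operator-sum form. -/
def IsCP (Φ : Op a →ₗ[ℂ] Op b) : Prop :=
  ∃ (r : ℕ) (K : Fin r → Matrix b a ℂ), Φ = krausMap K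

/-- Preservation of the trace. -/
def IsTP [Fintype b] (Φ : Op a →ₗ[ℂ] Op b) : Prop :=
  ∀ X, (Φ X).trace = X.trace

end Operations

/-! ### Multipartite systems

The parties are the elements of a finite type `ι`; party `i` holds the space with canonical basis
indexed by `A i`, so that the canonical basis of the global space is indexed by `∀ i, A i`. -/

section LOCC

variable {ι : Type} [Fintype ι] [DecidableEq ι]

/-- The tensor product `⨂ i, Φ i` of linear maps on local operators: the linear map that sends
`⨂ i, |a i⟩⟨a' i|` to `⨂ i, Φ i (|a i⟩⟨a' i|)`. -/
def tensorMap {A B : ι → Type} [∀ i, Fintype (A i)] [∀ i, DecidableEq (A i)]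
    (Φ : ∀ i, Op (A i) →ₗ[ℂ] Op (B i)) : Op (∀ i, A i) →ₗ[ℂ] Op (∀ i, B i) where
  toFun X := Matrix.of fun b b' =>
    ∑ a, ∑ a', X a a' * ∏ i, Φ i (Matrix.single (a i) (a' i) 1) (b i) (b' i)
  map_add' X Y := by
    ext b b'
    simp [add_mul, Finset.sum_add_distrib]
  map_smul' c X := by
    ext b b'
    simp [Finset.mul_sum, mul_assoc]

/-- Maps that are implemented by an LOCC protocol with finitely many rounds. Either every party
applies a local channel and the protocol ends, or one party `j` applies a local instrument and
broadcasts the outcome `x`, every other party applies a local channel that may depend on `x`, and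
the parties go on with an LOCC protocol that may depend on `x`. The local dimensions are
arbitrary at every stage. -/
inductive IsFiniteLOCC {B : ι → Type} [∀ i, Fintype (B i)] [∀ i, DecidableEq (B i)] :
    ∀ (A : ι → Type) [∀ i, Fintype (A i)] [∀ i, DecidableEq (A i)],
      (Op (∀ i, A i) →ₗ[ℂ] Op (∀ i, B i)) → Prop
  | localChannels (A : ι → Type) [∀ i, Fintype (A i)] [∀ i, DecidableEq (A i)]
      (Φ : ∀ i, Op (A i) →ₗ[ℂ] Op (B i))
      (cp : ∀ i, IsCP (Φ i)) (tp : ∀ i, IsTP (Φ i)) :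
      IsFiniteLOCC A (tensorMap Φ)
  | round (A : ι → Type) [∀ i, Fintype (A i)] [∀ i, DecidableEq (A i)]
      (j : ι) (m : ℕ) (C : Fin m → ι → Type)
      [∀ x i, Fintype (C x i)] [∀ x i, DecidableEq (C x i)]
      (Φ : ∀ x i, Op (A i) →ₗ[ℂ] Op (C x i))
      (cp : ∀ x i, IsCP (Φ x i))
      (tp : ∀ x i, i ≠ j → IsTP (Φ x i))
      (instr : ∀ X, ∑ x, (Φ x j X).trace = X.trace)
      (Λ : ∀ x, Op (∀ i, C x i) →ₗ[ℂ] Op (∀ i, B i))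
      (next : ∀ x, IsFiniteLOCC (C x) (Λ x)) :
      IsFiniteLOCC A (∑ x, Λ x ∘ₗ tensorMap (Φ x))

/-- LOCC maps, in the widest sense: limits of maps implemented by finite-round LOCC protocols.
This includes the finite-round maps and those of protocols with infinitely many rounds. -/
def IsLOCC {A B : ι → Type} [∀ i, Fintype (A i)] [∀ i, DecidableEq (A i)]
    [∀ i, Fintype (B i)] [∀ i, DecidableEq (B i)]
    (Λ : Op (∀ i, A i) →ₗ[ℂ] Op (∀ i, B i)) : Prop :=
  ∃ Λs : ℕ → (Op (∀ i, A i) →ₗ[ℂ] Op (∀ i, B i)),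
    (∀ r, IsFiniteLOCC A (Λs r)) ∧
      ∀ X, Filter.Tendsto (fun r => Λs r X) Filter.atTop (nhds (Λ X))

/-- `ρ^{⊗ k}` as a state of the same parties: party `i` holds the `i`-th share of each of the `k`
copies, that is, the space with canonical basis indexed by `Fin k → A i`. -/
def copies {A : ι → Type} (k : ℕ) (ρ : Op (∀ i, A i)) : Op (∀ i, Fin k → A i) :=
  Matrix.of fun s t => ∏ c, ρ (fun i => s i c) (fun i => t i c)

end LOCC

/-! ### GHZ states and their distillation -/

/-- The vector `(|0⟩^{⊗ n} + |1⟩^{⊗ n}) / √2`. -/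
def ghzVec (n : ℕ) : (Fin n → Fin 2) → ℂ := fun s =>
  ((1 / √2 : ℝ) : ℂ) * ((if s = fun _ => 0 then 1 else 0) + (if s = fun _ => 1 then 1 else 0))

/-- The `n`-qubit GHZ state. -/
def ghz (n : ℕ) : Op (Fin n → Fin 2) := ketbra (ghzVec n)

/-- An `n`-qubit state `ρ` is GHZ-distillable if there are LOCC maps `Λ k` from `k` copies to
`n` qubits, one held by each party, with `F(Λ k (ρ^{⊗ k}), GHZ) → 1` as `k → ∞`. -/
def GHZDistillable (n : ℕ) (ρ : Op (Fin n → Fin 2)) : Prop :=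
  ∃ Λ : ∀ k : ℕ, Op (Fin n → Fin k → Fin 2) →ₗ[ℂ] Op (Fin n → Fin 2),
    (∀ k, IsLOCC (A := fun _ : Fin n => Fin k → Fin 2) (B := fun _ : Fin n => Fin 2) (Λ k)) ∧
      Filter.Tendsto
        (fun k => fidelity (Λ k (copies (A := fun _ : Fin n => Fin 2) k ρ)) (ghz n))
        Filter.atTop (nhds 1)

/-! ### Noisy teleportation of qubits -/

/-- The two-qubit maximally entangled vector `|φ⁺⟩ = (|00⟩ + |11⟩) / √2`. -/
def phiPlus : Fin 2 × Fin 2 → ℂ := fun s => if s.1 = s.2 then ((1 / √2 : ℝ) : ℂ) else 0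

/-- The two-qubit isotropic state `p φ⁺ + (1 - p) 𝟙 / 4` of visibility `p`. -/
def isotropic (p : ℝ) : Op (Fin 2 × Fin 2) :=
  (p : ℂ) • ketbra phiPlus + (((1 - p) / 4 : ℝ) : ℂ) • 1

/-- The Pauli operators `X ^ u * Z ^ v`. -/
def pauli (u v : Fin 2) : Op (Fin 2) :=
  !![0, 1; 1, 0] ^ (u : ℕ) * !![1, 0; 0, -1] ^ (v : ℕ)

/-- The Bell basis `(X ^ u * Z ^ v ⊗ 𝟙) |φ⁺⟩`. -/
def bell (u v : Fin 2) : Fin 2 × Fin 2 → ℂ :=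
  (pauli u v ⊗ₖ (1 : Op (Fin 2))).mulVec phiPlus

/-- The standard teleportation protocol from qubit 1 to qubit 3: qubits 1 and 2 are measured in
the Bell basis and, on outcome `(u, v)`, the correction `X ^ u * Z ^ v` is applied to qubit 3. The
Kraus operator for this outcome is `⟨bell u v|₁₂ ⊗ X ^ u * Z ^ v`. -/
def teleport : Op (Fin 2 × (Fin 2 × Fin 2)) →ₗ[ℂ] Op (Fin 2) :=
  krausMap fun o : Fin 2 × Fin 2 =>
    Matrix.of fun k (s : Fin 2 × (Fin 2 × Fin 2)) =>
      star (bell o.1 o.2 (s.1, s.2.1)) * pauli o.1 o.2 k s.2.2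

/-- The noisy teleportation channel `ρ ↦ teleport (ρ ⊗ isotropic p)`. -/
def noisyTeleport (p : ℝ) : Op (Fin 2) →ₗ[ℂ] Op (Fin 2) where
  toFun ρ := teleport (ρ ⊗ₖ isotropic p)
  map_add' ρ σ := by simp [Matrix.add_kronecker]
  map_smul' c ρ := by simp [Matrix.smul_kronecker]

/-- The state of `n` parties after the centre of a star network, whose links are isotropic states
of visibility `p`, has teleported one share of a GHZ state to each of them. -/
def teleportedGHZ (p : ℝ) (n : ℕ) : Op (Fin n → Fin 2) :=
  tensorMap (fun _ : Fin n => noisyTeleport p) (ghz n)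

end

end GHZNetwork

namespace GHZNetwork

noncomputable section

open scoped Kronecker MatrixOrder ComplexOrder

open Filter Topology

/-! ### The partial transpose -/

section PartialTranspose

variable {ι : Type} [DecidableEq ι] {A : ι → Type}

/-! The obstruction is positivity of the partial transpose for a single party. It passes to tensor
powers (`IsPPTState.copies`) and is preserved by finite LOCC protocols and their limits
(`IsLOCC.isPPTState`). A state with this property has GHZ fidelity at most `1 / 2`
(`IsPPTState.fidelity_ghz_le`), so no sequence of LOCC maps can bring the fidelity to `1`.

It remains to see that the teleported GHZ state has the property for large `n`. Noisy teleportation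
is depolarizing, so the state is diagonal except for two entries `p ^ n / 2` linking `0…0` and `1…1`
(`teleportedGHZ_eq`). The partial transpose moves these to `10…0` and `01…1`, whose diagonal weights
are at least `(1 - p) / 2 * ((1 + p) / 2) ^ (n - 1) / 2`. As `p < (1 + p) / 2`, these weights
eventually dominate `p ^ n / 2`. -/

/-- Exchange the entry of party `q` between two global indices. -/
def swapAt (q : ι) (z : (∀ i, A i) × (∀ i, A i)) : (∀ i, A i) × (∀ i, A i) :=
  (Function.update z.1 q (z.2 q), Function.update z.2 q (z.1 q))

lemma swapAt_involutive (q : ι) : Function.Involutive (swapAt (A := A) q) := by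
  intro z
  simp [swapAt]

/-- The partial transpose with respect to party `q`. -/
def partialTranspose (q : ι) (X : Op (∀ i, A i)) : Op (∀ i, A i) :=
  Matrix.of fun s t => X (Function.update s q (t q)) (Function.update t q (s q))

lemma partialTranspose_sum {κ : Type} (q : ι) (s : Finset κ)
    (X : κ → Op (∀ i, A i)) :
    partialTranspose q (∑ x ∈ s, X x) = ∑ x ∈ s, partialTranspose q (X x) := by
  ext
  simp [partialTranspose, Matrix.sum_apply]

lemma partialTranspose_add (q : ι) (X Y : Op (∀ i, A i)) :
    partialTranspose q (X + Y) = partialTranspose q X + partialTranspose q Y := rfl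

lemma partialTranspose_smul (q : ι) (c : ℂ) (X : Op (∀ i, A i)) :
    partialTranspose q (c • X) = c • partialTranspose q X := rfl

/-- The swap of index pairs fixes every pair `(t, t)`; being injective, it sends no other pair to
the diagonal. -/
lemma partialTranspose_diagonal [DecidableEq (∀ i, A i)] (q : ι) (d : (∀ i, A i) → ℂ) :
    partialTranspose q (Matrix.diagonal d) = Matrix.diagonal d := by
  ext s t
  by_cases h : s = t
  · subst h
    simp [partialTranspose]
  · have : Function.update s q (t q) ≠ Function.update t q (s q) := by
      intro e
      have e' : swapAt q (s, t) = swapAt q (t, t) := by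
        have hq : s q = t q := by simpa using (congrFun e q).symm
        simp only [swapAt, e, hq]
      exact h (congrArg Prod.fst ((swapAt_involutive q).injective e'))
    simp [partialTranspose, h, this]

lemma partialTranspose_single [DecidableEq (∀ i, A i)] (q : ι) (s t : ∀ i, A i) (c : ℂ) :
    partialTranspose q (Matrix.single s t c) =
      Matrix.single (Function.update s q (t q)) (Function.update t q (s q)) c := by
  ext x y
  have h : (s = Function.update x q (y q) ∧ t = Function.update y q (x q)) ↔
      (Function.update s q (t q) = x ∧ Function.update t q (s q) = y) := by
    have := (swapAt_involutive q).eq_iff (x := (s, t)) (y := (x, y))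
    simpa [swapAt] using this.symm
  simp only [partialTranspose, Matrix.of_apply, Matrix.single_apply, h]

lemma partialTranspose_copies (q : ι) (k : ℕ) (X : Op (∀ i, A i)) :
    partialTranspose q (copies k X) = copies k (partialTranspose q X) := by
  ext s t
  simp only [partialTranspose, copies, Matrix.of_apply]
  refine Finset.prod_congr rfl fun c _ => ?_
  congr 1 <;> · ext i; by_cases h : i = q <;> [(subst h; simp); simp [h]]

end PartialTranspose

/-! ### Positivity and traces under tensor products of maps -/

/-- Hermiticity and, for each fixed vector, nonnegativity of the quadratic form are closed
conditions. This is what carries positivity to limits of protocols. -/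
lemma isClosed_setOf_posSemidef {a : Type} [Fintype a] :
    IsClosed {X : Op a | X.PosSemidef} := by
  have h : {X : Op a | X.PosSemidef} =
      {X | X.conjTranspose = X} ∩ ⋂ v : a → ℂ, {X | 0 ≤ star v ⬝ᵥ X.mulVec v} := by
    ext X
    simp [Matrix.posSemidef_iff_dotProduct_mulVec, Matrix.IsHermitian]
  rw [h]
  refine (isClosed_eq (by fun_prop) (by fun_prop)).inter (isClosed_iInter fun v => ?_)
  exact isClosed_le continuous_const
    (continuous_const.dotProduct (continuous_id.matrix_mulVec continuous_const))

section Tensor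

variable {ι : Type} [Fintype ι] [DecidableEq ι]

/-- Tensor products of completely positive maps preserve positivity. -/
lemma posSemidef_tensorMap {A B : ι → Type} [∀ i, Fintype (A i)] [∀ i, DecidableEq (A i)]
    [∀ i, Fintype (B i)] {Φ : ∀ i, Op (A i) →ₗ[ℂ] Op (B i)} (cp : ∀ i, IsCP (Φ i))
    {X : Op (∀ i, A i)} (hX : X.PosSemidef) : (tensorMap Φ X).PosSemidef := by
  choose r K hK using cp
  -- Tensor products of local Kraus operators, one for each tuple of local labels, are Kraus
  -- operators for the product map.
  let N : (∀ i, Fin (r i)) → Matrix (∀ i, B i) (∀ i, A i) ℂ :=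
    fun y => Matrix.of fun b a => ∏ i, K i (y i) (b i) (a i)
  have key : tensorMap Φ X = ∑ y, N y * X * (N y).conjTranspose := by
    ext b b'
    have h1 : ∀ a a' : ∀ i, A i, ∏ i, Φ i (Matrix.single (a i) (a' i) 1) (b i) (b' i)
        = ∑ y, N y b a * star (N y b' a') := by
      intro a a'
      have : ∀ i, Φ i (Matrix.single (a i) (a' i) 1) (b i) (b' i)
          = ∑ y, K i y (b i) (a i) * star (K i y (b' i) (a' i)) := by
        intro i
        rw [hK i]
        simp [krausMap, Matrix.sum_apply, Matrix.mul_apply, Matrix.single_apply, ite_and]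
      simp_rw [this, N, Matrix.of_apply, star_prod, ← Finset.prod_mul_distrib]
      rw [Finset.prod_univ_sum, Fintype.piFinset_univ]
    simp only [tensorMap, LinearMap.coe_mk, AddHom.coe_mk, Matrix.of_apply, h1,
      Matrix.sum_apply, Matrix.mul_apply, Matrix.conjTranspose_apply, Finset.mul_sum,
      Finset.sum_mul]
    rw [Finset.sum_comm]
    simp_rw [Finset.sum_comm (s := Finset.univ (α := ∀ i, A i)) (t := Finset.univ (α := ∀ i, Fin (r i)))]
    refine Finset.sum_congr rfl fun y _ => ?_
    refine Finset.sum_congr rfl fun a _ => Finset.sum_congr rfl fun a' _ => ?_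
    ring
  rw [key]
  exact Matrix.posSemidef_sum _ fun y _ => hX.mul_mul_conjTranspose_same (N y)

/-- The trace of the image under a tensor product of maps. -/
lemma trace_tensorMap {A B : ι → Type} [∀ i, Fintype (A i)] [∀ i, DecidableEq (A i)]
    [∀ i, Fintype (B i)] (Φ : ∀ i, Op (A i) →ₗ[ℂ] Op (B i)) (X : Op (∀ i, A i)) :
    (tensorMap Φ X).trace =
      ∑ a, ∑ a', X a a' * ∏ i, (Φ i (Matrix.single (a i) (a' i) 1)).trace := by
  simp only [Matrix.trace, Matrix.diag, tensorMap, LinearMap.coe_mk, AddHom.coe_mk,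
    Matrix.of_apply]
  rw [Finset.sum_comm]
  refine Finset.sum_congr rfl fun a _ => ?_
  rw [Finset.sum_comm]
  refine Finset.sum_congr rfl fun a' _ => ?_
  rw [← Finset.mul_sum, Finset.prod_univ_sum, Fintype.piFinset_univ]

/-- If one party applies an instrument and the others apply channels, the total trace is
preserved. -/
lemma sum_trace_tensorMap {A : ι → Type} [∀ i, Fintype (A i)] [∀ i, DecidableEq (A i)]
    (j : ι) {κ : Type} [Fintype κ] {C : κ → ι → Type} [∀ x i, Fintype (C x i)]
    {Φ : ∀ x i, Op (A i) →ₗ[ℂ] Op (C x i)} (tp : ∀ x i, i ≠ j → IsTP (Φ x i))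
    (instr : ∀ X, ∑ x, (Φ x j X).trace = X.trace) (X : Op (∀ i, A i)) :
    ∑ x, (tensorMap (Φ x) X).trace = X.trace := by
  have h1 : ∀ a a' : ∀ i, A i, ∑ x, ∏ i, (Φ x i (Matrix.single (a i) (a' i) 1)).trace
      = if a = a' then 1 else 0 := by
    intro a a'
    -- By trace preservation, only the factor of party `j` depends on `x`.
    have h2 : ∀ x, ∏ i, (Φ x i (Matrix.single (a i) (a' i) 1)).trace
        = (Φ x j (Matrix.single (a j) (a' j) 1)).trace *
          ∏ i ∈ Finset.univ.erase j, (Matrix.single (a i) (a' i) (1 : ℂ)).trace := by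
      intro x
      rw [← Finset.mul_prod_erase _ _ (Finset.mem_univ j)]
      congr 1
      exact Finset.prod_congr rfl fun i hi => tp x i (Finset.ne_of_mem_erase hi) _
    simp_rw [h2]
    rw [← Finset.sum_mul, instr,
      Finset.mul_prod_erase _ (fun i => (Matrix.single (a i) (a' i) (1 : ℂ)).trace)
        (Finset.mem_univ j)]
    simp [Matrix.trace, Matrix.single_apply, ite_and, Fintype.prod_ite_zero, funext_iff, eq_comm]
  simp_rw [trace_tensorMap]
  rw [Finset.sum_comm]
  simp_rw [Finset.sum_comm (s := Finset.univ (α := κ)), ← Finset.mul_sum, h1]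
  simp [Matrix.trace]

/-- Tensor products of trace-preserving maps preserve the trace. -/
lemma isTP_tensorMap {A B : ι → Type} [∀ i, Fintype (A i)] [∀ i, DecidableEq (A i)]
    [∀ i, Fintype (B i)] {Φ : ∀ i, Op (A i) →ₗ[ℂ] Op (B i)} (tp : ∀ i, IsTP (Φ i)) :
    IsTP (tensorMap Φ) := by
  intro X
  rw [trace_tensorMap]
  have h : ∀ a a' : ∀ i, A i, ∏ i, (Φ i (Matrix.single (a i) (a' i) 1)).trace
      = ∏ i, (Matrix.single (a i) (a' i) (1 : ℂ)).trace :=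
    fun a a' => Finset.prod_congr rfl fun i _ => tp i _
  simp_rw [h]
  simp [Matrix.trace, Matrix.single_apply, ite_and, Fintype.prod_ite_zero, ← funext_iff]

/-- The map `X ↦ (Φ Xᵀ)ᵀ`. -/
def transposeMap {a b : Type} (Φ : Op a →ₗ[ℂ] Op b) : Op a →ₗ[ℂ] Op b where
  toFun X := (Φ X.transpose).transpose
  map_add' X Y := by simp
  map_smul' c X := by simp

/-- Transposing `K Xᵀ K†` gives `K̄ X K̄†`: the Kraus operators are conjugated entrywise. -/
lemma isCP_transposeMap {a b : Type} [Fintype a] {Φ : Op a →ₗ[ℂ] Op b} (h : IsCP Φ) :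
    IsCP (transposeMap Φ) := by
  obtain ⟨r, K, rfl⟩ := h
  refine ⟨r, fun y => (K y).map star, ?_⟩
  ext1 X
  ext i j
  simp only [transposeMap, krausMap, LinearMap.coe_mk, AddHom.coe_mk, Matrix.transpose_apply,
    Matrix.sum_apply]
  refine Finset.sum_congr rfl fun y _ => ?_
  rw [← Matrix.transpose_apply (K y * _ * _), Matrix.transpose_mul, Matrix.transpose_mul,
    Matrix.transpose_transpose, ← Matrix.mul_assoc]
  have h : ((K y).map star).conjTranspose = (K y).transpose := by
    ext
    simp
  rw [h]
  rfl

/-- Reindexing the double sum by `swapAt q` moves the transposition inside; party `q`'s factor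
becomes its `transposeMap`, which is again completely positive if the factor was. Hence local
operations cannot destroy positivity of the partial transpose. -/
lemma partialTranspose_tensorMap {A B : ι → Type} [∀ i, Fintype (A i)]
    [∀ i, DecidableEq (A i)] (q : ι) (Φ : ∀ i, Op (A i) →ₗ[ℂ] Op (B i)) (X : Op (∀ i, A i)) :
    partialTranspose q (tensorMap Φ X) =
      tensorMap (fun i => if i = q then transposeMap (Φ i) else Φ i) (partialTranspose q X) := by
  ext b b'
  simp only [partialTranspose, tensorMap, LinearMap.coe_mk, AddHom.coe_mk, Matrix.of_apply]
  rw [← Fintype.sum_prod_type', ← Fintype.sum_prod_type',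
    ← Equiv.sum_comp (swapAt_involutive q).toPerm]
  refine Finset.sum_congr rfl fun z _ => ?_
  simp only [Function.Involutive.coe_toPerm, swapAt]
  congr 1
  refine Finset.prod_congr rfl fun i _ => ?_
  by_cases h : i = q
  · subst h
    simp [transposeMap, Matrix.transpose_single]
  · simp [h]

/-! ### LOCC maps preserve states with positive partial transpose -/

/-- Density operators whose partial transpose with respect to party `q` is positive. -/
structure IsPPTState {A : ι → Type} [∀ i, Fintype (A i)] (q : ι) (X : Op (∀ i, A i)) :
    Prop where
  posSemidef : X.PosSemidef
  posSemidef_partialTranspose : (partialTranspose q X).PosSemidef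
  trace_eq_one : X.trace = 1

lemma posSemidef_partialTranspose_tensorMap {A B : ι → Type} [∀ i, Fintype (A i)]
    [∀ i, DecidableEq (A i)] [∀ i, Fintype (B i)] (q : ι)
    {Φ : ∀ i, Op (A i) →ₗ[ℂ] Op (B i)} (cp : ∀ i, IsCP (Φ i)) {X : Op (∀ i, A i)}
    (hX : (partialTranspose q X).PosSemidef) :
    (partialTranspose q (tensorMap Φ X)).PosSemidef := by
  rw [partialTranspose_tensorMap]
  refine posSemidef_tensorMap (fun i => ?_) hX
  split_ifs
  · exact isCP_transposeMap (cp i)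
  · exact cp i

section FiniteLOCC

variable {A B : ι → Type} [∀ i, Fintype (A i)] [∀ i, DecidableEq (A i)]
  [∀ i, Fintype (B i)] [∀ i, DecidableEq (B i)] {Λ : Op (∀ i, A i) →ₗ[ℂ] Op (∀ i, B i)}

lemma IsFiniteLOCC.isTP (h : IsFiniteLOCC A Λ) : IsTP Λ := by
  induction h with
  | localChannels A Φ cp tp => exact isTP_tensorMap tp
  | round A j m C Φ cp tp instr Λ next ih =>
    intro X
    rw [← sum_trace_tensorMap j tp instr X]
    rw [LinearMap.sum_apply, Matrix.trace_sum]
    exact Finset.sum_congr rfl fun x _ => ih x _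

lemma IsFiniteLOCC.posSemidef (h : IsFiniteLOCC A Λ) {X : Op (∀ i, A i)} (hX : X.PosSemidef) :
    (Λ X).PosSemidef := by
  induction h with
  | localChannels A Φ cp tp => exact posSemidef_tensorMap cp hX
  | round A j m C Φ cp tp instr Λ next ih =>
    rw [LinearMap.sum_apply]
    exact Matrix.posSemidef_sum _ fun x _ => ih x (posSemidef_tensorMap (cp x) hX)

lemma IsFiniteLOCC.posSemidef_partialTranspose (q : ι) (h : IsFiniteLOCC A Λ)
    {X : Op (∀ i, A i)} (hX : (partialTranspose q X).PosSemidef) :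
    (partialTranspose q (Λ X)).PosSemidef := by
  induction h with
  | localChannels A Φ cp tp => exact posSemidef_partialTranspose_tensorMap q cp hX
  | round A j m C Φ cp tp instr Λ next ih =>
    rw [LinearMap.sum_apply, partialTranspose_sum]
    exact Matrix.posSemidef_sum _ fun x _ =>
      ih x (posSemidef_partialTranspose_tensorMap q (cp x) hX)

lemma IsLOCC.isPPTState {q : ι} (h : IsLOCC Λ) {X : Op (∀ i, A i)} (hX : IsPPTState q X) :
    IsPPTState q (Λ X) := by
  obtain ⟨Λs, hΛs, hlim⟩ := h
  refine ⟨?_, ?_, ?_⟩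
  · exact isClosed_setOf_posSemidef.mem_of_tendsto (hlim X)
      (Eventually.of_forall fun r => (hΛs r).posSemidef hX.posSemidef)
  · have hc : Continuous (partialTranspose (A := B) q) :=
      continuous_matrix fun s t => by
        simp only [partialTranspose, Matrix.of_apply]
        exact continuous_id.matrix_elem _ _
    exact isClosed_setOf_posSemidef.mem_of_tendsto ((hc.tendsto _).comp (hlim X))
      (Eventually.of_forall fun r =>
        (hΛs r).posSemidef_partialTranspose q hX.posSemidef_partialTranspose)
  · have hc : Continuous (Matrix.trace : Op (∀ i, B i) → ℂ) := continuous_id.matrix_trace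
    refine tendsto_nhds_unique ((hc.tendsto _).comp (hlim X)) ?_
    have : (Matrix.trace ∘ fun r => Λs r X) = fun _ => (1 : ℂ) := by
      ext r
      simp [(hΛs r).isTP X, hX.trace_eq_one]
    rw [this]
    exact tendsto_const_nhds

end FiniteLOCC

/-! ### Copies -/

section Copies

variable {A : ι → Type} [∀ i, Fintype (A i)]

lemma posSemidef_copies [∀ i, DecidableEq (A i)] (k : ℕ) {X : Op (∀ i, A i)}
    (hX : X.PosSemidef) : (copies k X).PosSemidef := by
  obtain ⟨Y, rfl⟩ := CStarAlgebra.nonneg_iff_eq_star_mul_self.mp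
    (Matrix.nonneg_iff_posSemidef.mpr hX)
  -- The `k`-th tensor power of `Y`, with columns regrouped by party and rows still grouped by copy.
  let D : Matrix (Fin k → ∀ i, A i) (∀ i, Fin k → A i) ℂ :=
    Matrix.of fun u s => ∏ c, Y (u c) (fun i => s i c)
  have : copies k (star Y * Y) = D.conjTranspose * D := by
    ext s t
    simp only [copies, Matrix.of_apply, Matrix.mul_apply, Matrix.star_apply, D,
      Matrix.conjTranspose_apply, star_prod, ← Finset.prod_mul_distrib]
    rw [Finset.prod_univ_sum, Fintype.piFinset_univ]
  rw [this]
  exact Matrix.posSemidef_conjTranspose_mul_self D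

lemma trace_copies (k : ℕ) (X : Op (∀ i, A i)) : (copies k X).trace = X.trace ^ k := by
  simp only [Matrix.trace, Matrix.diag, copies, Matrix.of_apply]
  rw [← Fin.prod_const, Finset.prod_univ_sum, Fintype.piFinset_univ,
    ← Equiv.sum_comp (Equiv.piComm fun (_ : Fin k) i => A i)]
  rfl

lemma IsPPTState.copies [∀ i, DecidableEq (A i)] {q : ι} {X : Op (∀ i, A i)}
    (hX : IsPPTState q X) (k : ℕ) : IsPPTState q (copies k X) where
  posSemidef := posSemidef_copies k hX.posSemidef
  posSemidef_partialTranspose := by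
    rw [partialTranspose_copies]
    exact posSemidef_copies k hX.posSemidef_partialTranspose
  trace_eq_one := by rw [trace_copies, hX.trace_eq_one, one_pow]

end Copies

end Tensor

/-! ### Fidelity with a pure state -/

lemma fidelity_ketbra {a : Type} [Fintype a] [DecidableEq a] {X : Op a} (hX : X.PosSemidef)
    (v : a → ℂ) : fidelity X (ketbra v) = (star v ⬝ᵥ X.mulVec v).re := by
  set R : Op a := CFC.sqrt X with hR
  have hR0 : R.PosSemidef := Matrix.nonneg_iff_posSemidef.mp (CFC.sqrt_nonneg X)
  have hRR : R * R = X := CFC.sqrt_mul_sqrt_self X (Matrix.nonneg_iff_posSemidef.mpr hX)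
  have hRh : R.conjTranspose = R := hR0.isHermitian
  set w : a → ℂ := R.mulVec v with hw
  have h1 : R * ketbra v * R = ketbra w := by
    rw [ketbra, Matrix.mul_vecMulVec, Matrix.vecMulVec_mul, ketbra, hw, Matrix.star_mulVec, hRh]
  set c : ℂ := star v ⬝ᵥ X.mulVec v with hc
  have h2 : star w ⬝ᵥ w = c := by
    rw [hw, Matrix.star_mulVec, hRh, ← Matrix.dotProduct_mulVec, Matrix.mulVec_mulVec, hRR]
  have hc0 : 0 ≤ c := hX.dotProduct_mulVec_nonneg v
  obtain ⟨r, hr0, hr⟩ : ∃ r : ℝ, 0 ≤ r ∧ c = r :=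
    ⟨c.re, (Complex.nonneg_iff.mp hc0).1, Complex.eq_re_of_ofReal_le hc0⟩
  have htr : (ketbra w).trace = c := by
    rw [ketbra, Matrix.trace_vecMulVec, dotProduct_comm, h2]
  have hsq : ketbra w * ketbra w = c • ketbra w := by
    rw [ketbra, Matrix.vecMulVec_mul_vecMulVec, h2]
    ext i j
    simp only [Matrix.vecMulVec_apply, Matrix.smul_apply, Pi.smul_apply, Pi.star_apply,
      smul_eq_mul]
    ring
  -- `ketbra w` is `r` times a projector, so its root divides it by `√r`. If `r = 0`, then `w = 0`,
  -- and the convention `0⁻¹ = 0` keeps the formula valid.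
  have hroot : CFC.sqrt (ketbra w) = (((√r)⁻¹ : ℝ) : ℂ) • ketbra w := by
    refine CFC.sqrt_unique ?_ (Matrix.nonneg_iff_posSemidef.mpr ?_)
    · rw [smul_mul_smul_comm, hsq, smul_smul]
      rcases eq_or_lt_of_le hr0 with h0 | h0
      · have hw0 : w = 0 := by
          rw [← dotProduct_star_self_eq_zero, h2, hr, ← h0]
          simp
        simp [hw0, ketbra]
      · have : (((√r)⁻¹ : ℝ) : ℂ) * (((√r)⁻¹ : ℝ) : ℂ) * c = 1 := by
          rw [hr, ← Complex.ofReal_mul, ← Complex.ofReal_mul, ← mul_inv,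
            Real.mul_self_sqrt hr0, inv_mul_cancel₀ h0.ne', Complex.ofReal_one]
        rw [this, one_smul]
    · refine (Matrix.posSemidef_vecMulVec_self_star w).smul ?_
      exact_mod_cast inv_nonneg.mpr (Real.sqrt_nonneg r)
  rw [fidelity, ← hR, h1, hroot, Matrix.trace_smul, htr, hr, smul_eq_mul, ← Complex.ofReal_mul,
    Complex.ofReal_re, Complex.ofReal_re, mul_pow, inv_pow, Real.sq_sqrt hr0]
  rcases eq_or_lt_of_le hr0 with h0 | h0
  · simp [← h0]
  · field_simp

/-! ### The GHZ fidelity of states with positive partial transpose -/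

lemma ghz_apply (n : ℕ) (s t : Fin n → Fin 2) :
    ghz n s t = 1 / 2 *
      (((if s = fun _ => 0 then 1 else 0) + (if s = fun _ => 1 then 1 else 0)) *
        ((if t = fun _ => 0 then 1 else 0) + (if t = fun _ => 1 then 1 else 0))) := by
  have h : ((1 / √2 : ℝ) : ℂ) * ((1 / √2 : ℝ) : ℂ) = 1 / 2 := by
    rw [← Complex.ofReal_mul, div_mul_div_comm, Real.mul_self_sqrt (by norm_num)]
    norm_num
  rw [← h]
  simp only [ghz, ketbra, Matrix.vecMulVec_apply, ghzVec, Pi.star_apply, star_mul', star_add]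
  simp only [apply_ite star, star_one, star_zero, Complex.star_def, Complex.conj_ofReal]
  ring

lemma star_ghzVec_dotProduct (n : ℕ) (X : Op (Fin n → Fin 2)) :
    star (ghzVec n) ⬝ᵥ X.mulVec (ghzVec n) =
      1 / 2 * (X (fun _ => 0) (fun _ => 0) + X (fun _ => 1) (fun _ => 1) +
        (X (fun _ => 0) (fun _ => 1) + X (fun _ => 1) (fun _ => 0))) := by
  have h : star (ghzVec n) ⬝ᵥ X.mulVec (ghzVec n) = ∑ s, ∑ t, ghz n t s * X s t := by
    simp only [dotProduct, Matrix.mulVec, Finset.mul_sum]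
    refine Finset.sum_congr rfl fun s _ => Finset.sum_congr rfl fun t _ => ?_
    simp only [ghz, ketbra, Matrix.vecMulVec_apply, Pi.star_apply]
    ring
  rw [h]
  simp only [ghz_apply]
  simp only [mul_add, add_mul, Finset.sum_add_distrib, mul_ite, ite_mul, mul_one, mul_zero,
    zero_mul, Finset.sum_ite_eq', Finset.mem_univ, if_true, Finset.sum_ite_irrel,
    Finset.sum_const_zero]
  ring

/-- Across a bipartition, a state with positive partial transpose has GHZ fidelity at most
`1 / 2`. -/
lemma IsPPTState.fidelity_ghz_le {n : ℕ} {q r : Fin n} (hqr : r ≠ q) {X : Op (Fin n → Fin 2)}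
    (hX : IsPPTState q X) : fidelity X (ghz n) ≤ 1 / 2 := by
  rw [ghz, fidelity_ketbra hX.posSemidef, star_ghzVec_dotProduct]
  set z : Fin n → Fin 2 := fun _ => 0 with hz
  set o : Fin n → Fin 2 := fun _ => 1 with ho
  -- Swapping the bit of `q` turns the index pair `(u, v)` into `(z, o)`, so the GHZ coherence is
  -- the `(u, v)` entry of the partial transpose. Party `r` keeps `u` and `v` distinct from `o` and
  -- `z`.
  set u : Fin n → Fin 2 := Function.update z q 1 with hu
  set v : Fin n → Fin 2 := Function.update o q 0 with hv
  have hzq : z q = 0 := rfl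
  have hzr : z r = 0 := rfl
  have hoq : o q = 1 := rfl
  have hor : o r = 1 := rfl
  have huq : u q = 1 := by simp [hu]
  have hur : u r = 0 := by simp [hu, hqr, hz]
  have hvq : v q = 0 := by simp [hv]
  have hvr : v r = 1 := by simp [hv, hqr, ho]
  have hne : ∀ {s t : Fin n → Fin 2} (i : Fin n), s i ≠ t i → s ≠ t :=
    fun i h e => h (congrFun e i)
  have hzo : z ≠ o := hne q (by simp [hzq, hoq])
  have hzu : z ≠ u := hne q (by simp [hzq, huq])
  have hzv : z ≠ v := hne r (by simp [hzr, hvr])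
  have hou : o ≠ u := hne r (by simp [hor, hur])
  have hov : o ≠ v := hne q (by simp [hoq, hvq])
  have huv : u ≠ v := hne q (by simp [huq, hvq])
  have huz : Function.update u q 0 = z := by
    rw [hu, Function.update_idem, ← hzq, Function.update_eq_self]
  have hvo : Function.update v q 1 = o := by
    rw [hv, Function.update_idem, ← hoq, Function.update_eq_self]
  have huu : Function.update u q 1 = u := by rw [← huq, Function.update_eq_self]
  have hvv : Function.update v q 0 = v := by rw [← hvq, Function.update_eq_self]
  have hdiag : ∀ s, 0 ≤ (X s s).re :=
    fun s => (Complex.nonneg_iff.mp hX.posSemidef.diag_nonneg).1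
  have hoff : (X z o).re + (X o z).re ≤ (X u u).re + (X v v).re := by
    -- Testing the partial transpose on `e_u - e_v` bounds the coherences by two populations. The
    -- fidelity is then at most half the sum of four distinct diagonal entries.
    have h := (Complex.nonneg_iff.mp (hX.posSemidef_partialTranspose.dotProduct_mulVec_nonneg
      (Pi.single u 1 - Pi.single v 1))).1
    have hst : star (Pi.single u 1 - Pi.single v 1 : (Fin n → Fin 2) → ℂ)
        = Pi.single u 1 - Pi.single v 1 := by
      rw [star_sub, Pi.star_single, Pi.star_single, star_one]
    rw [hst, Matrix.mulVec_sub, sub_dotProduct, dotProduct_sub, dotProduct_sub] at h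
    simp only [Matrix.mulVec_single_one, single_dotProduct, one_mul, Matrix.col_apply,
      partialTranspose, Matrix.of_apply, huq, hvq, huz, hvo, Complex.sub_re] at h
    rw [huu, hvv] at h
    linarith
  have htr : (X z z).re + (X o o).re + (X u u).re + (X v v).re ≤ 1 := by
    have h1 : ∑ s, (X s s).re = 1 := by
      have := congrArg Complex.re hX.trace_eq_one
      simpa [Matrix.trace] using this
    rw [← h1]
    calc _ = ∑ s ∈ ({z, o, u, v} : Finset (Fin n → Fin 2)), (X s s).re := by
          rw [Finset.sum_insert (by simp [hzo, hzu, hzv]),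
            Finset.sum_insert (by simp [hou, hov]), Finset.sum_insert (by simp [huv]),
            Finset.sum_singleton]
          ring
      _ ≤ _ := Finset.sum_le_sum_of_subset_of_nonneg (Finset.subset_univ _)
          fun s _ _ => hdiag s
  have : (1 / 2 * (X z z + X o o + (X z o + X o z))).re
      = 1 / 2 * ((X z z).re + (X o o).re + ((X z o).re + (X o z).re)) := by
    rw [show (1 / 2 : ℂ) = ((1 / 2 : ℝ) : ℂ) by norm_num, Complex.re_ofReal_mul]
    simp
  rw [this]
  linarith

/-- States of at least two qubits with positive partial transpose for one party are not
GHZ-distillable. -/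
lemma IsPPTState.not_ghzDistillable {n : ℕ} {q r : Fin n} (hqr : r ≠ q)
    {X : Op (Fin n → Fin 2)} (hX : IsPPTState q X) : ¬ GHZDistillable n X := by
  rintro ⟨Λ, hΛ, hlim⟩
  have := le_of_tendsto' hlim fun k =>
    IsPPTState.fidelity_ghz_le hqr ((hΛ k).isPPTState (hX.copies k))
  norm_num at this

/-! ### The teleported GHZ state -/

lemma bell_apply (u v x y : Fin 2) :
    bell u v (x, y) = ((1 / √2 : ℝ) : ℂ) * pauli u v x y := by
  simp only [bell, Matrix.mulVec, dotProduct, Matrix.kroneckerMap_apply, Fintype.sum_prod_type,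
    phiPlus]
  fin_cases y <;> simp [Matrix.one_apply] <;> ring

/-- Noisy teleportation is a depolarizing channel. -/
lemma noisyTeleport_apply (p : ℝ) (X : Op (Fin 2)) :
    noisyTeleport p X = (p : ℂ) • X + ((1 - p) / 2 * X.trace) • (1 : Op (Fin 2)) := by
  have h : ((√2 : ℝ) : ℂ)⁻¹ * ((√2 : ℝ) : ℂ)⁻¹ = 1 / 2 := by
    rw [← mul_inv, ← Complex.ofReal_mul, Real.mul_self_sqrt (by norm_num)]
    norm_num
  have h2 : ((√2 : ℝ) : ℂ)⁻¹ ^ 2 = 1 / 2 := by rw [sq, h]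
  have h4 : ((√2 : ℝ) : ℂ)⁻¹ ^ 4 = 1 / 4 := by
    rw [show 4 = 2 * 2 from rfl, pow_mul, h2]; norm_num
  ext i j
  simp only [noisyTeleport, teleport, krausMap, isotropic, ketbra, LinearMap.coe_mk,
    AddHom.coe_mk, Matrix.mul_apply, Matrix.of_apply, Fintype.sum_prod_type,
    Matrix.kroneckerMap_apply, Matrix.conjTranspose_apply, bell_apply, Fin.sum_univ_two,
    Matrix.add_apply, Matrix.smul_apply, Matrix.vecMulVec_apply, phiPlus, Pi.star_apply]
  fin_cases i <;> fin_cases j <;>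
    · simp [pauli, Matrix.trace, Fin.sum_univ_two]
      ring_nf
      simp only [h2, h4]
      ring

/-- Taking `c` from the diagonal at `s` and `t` completes the off-diagonal pair to `c` times the
projector-like `ketbra (e_s + e_t)`, and leaves a nonnegative diagonal. It serves both the state and
its partial transpose. -/
lemma posSemidef_diagonal_add_single {a : Type} [Fintype a] [DecidableEq a] {d : a → ℝ}
    (hd : ∀ i, 0 ≤ d i) {s t : a} (hst : s ≠ t) {c : ℝ} (hc : 0 ≤ c) (hs : c ≤ d s)
    (ht : c ≤ d t) :
    (Matrix.diagonal (fun i => (d i : ℂ)) +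
      (c : ℂ) • (Matrix.single s t 1 + Matrix.single t s 1)).PosSemidef := by
  let w : a → ℂ := Pi.single s 1 + Pi.single t 1
  have key : Matrix.diagonal (fun i => (d i : ℂ)) +
      (c : ℂ) • (Matrix.single s t 1 + Matrix.single t s 1) =
      Matrix.diagonal (fun i => ((d i - if i = s ∨ i = t then c else 0 : ℝ) : ℂ)) +
        (c : ℂ) • Matrix.vecMulVec w (star w) := by
    ext i j
    simp only [w, Matrix.add_apply, Matrix.smul_apply, Matrix.vecMulVec_apply, Pi.star_apply,
      Matrix.diagonal_apply, Matrix.single_apply, Pi.add_apply, Pi.single_apply, star_add,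
      apply_ite star, star_one, star_zero, smul_eq_mul, Complex.ofReal_sub, apply_ite Complex.ofReal,
      Complex.ofReal_zero]
    grind
  rw [key]
  refine Matrix.PosSemidef.add (Matrix.PosSemidef.diagonal fun i => ?_)
    ((Matrix.posSemidef_vecMulVec_self_star w).smul (by exact_mod_cast hc))
  refine Complex.zero_le_real.mpr ?_
  have := hd i
  split_ifs with h
  · rcases h with rfl | rfl <;> linarith
  · linarith

/-- The diagonal entries of the teleported GHZ state. -/
def teleportedWeight (p : ℝ) {n : ℕ} (s : Fin n → Fin 2) : ℝ :=
  (∏ i, (if s i = 0 then (1 + p) / 2 else (1 - p) / 2) +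
    ∏ i, (if s i = 0 then (1 - p) / 2 else (1 + p) / 2)) / 2

/-- The channel damps each coherence `|0⟩⟨1|`, `|1⟩⟨0|` by `p`, and sends `|0⟩⟨0|`, `|1⟩⟨1|` to
diagonal matrices with entries `(1 ± p) / 2`. The four terms of the GHZ projector are treated
separately. -/
lemma teleportedGHZ_eq (p : ℝ) (n : ℕ) :
    teleportedGHZ p n = Matrix.diagonal (fun s => (teleportedWeight p s : ℂ)) +
      ((p ^ n / 2 : ℝ) : ℂ) • (Matrix.single (fun _ => 0) (fun _ => 1) 1 +
        Matrix.single (fun _ => 1) (fun _ => 0) 1) := by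
  ext b b'
  have hsum : teleportedGHZ p n b b' = 1 / 2 *
      ((∏ i, noisyTeleport p (Matrix.single 0 0 1) (b i) (b' i) +
        ∏ i, noisyTeleport p (Matrix.single 1 1 1) (b i) (b' i)) +
      (∏ i, noisyTeleport p (Matrix.single 0 1 1) (b i) (b' i) +
        ∏ i, noisyTeleport p (Matrix.single 1 0 1) (b i) (b' i))) := by
    simp only [teleportedGHZ, tensorMap, LinearMap.coe_mk, AddHom.coe_mk, Matrix.of_apply,
      ghz_apply]
    simp only [mul_add, add_mul, Finset.sum_add_distrib, mul_ite, ite_mul, mul_one, mul_zero,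
      zero_mul, Finset.sum_ite_eq', Finset.mem_univ, if_true]
    ring
  have h00 : ∀ x y : Fin 2, noisyTeleport p (Matrix.single 0 0 1) x y =
      if x = y then (((if x = 0 then (1 + p) / 2 else (1 - p) / 2 : ℝ)) : ℂ) else 0 := by
    intro x y
    rw [noisyTeleport_apply]
    fin_cases x <;> fin_cases y <;> norm_num [Matrix.trace] <;> ring
  have h11 : ∀ x y : Fin 2, noisyTeleport p (Matrix.single 1 1 1) x y =
      if x = y then (((if x = 0 then (1 - p) / 2 else (1 + p) / 2 : ℝ)) : ℂ) else 0 := by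
    intro x y
    rw [noisyTeleport_apply]
    fin_cases x <;> fin_cases y <;> norm_num [Matrix.trace] <;> ring
  have h01 : ∀ x y : Fin 2, noisyTeleport p (Matrix.single 0 1 1) x y =
      if 0 = x ∧ 1 = y then (p : ℂ) else 0 := by
    intro x y
    rw [noisyTeleport_apply]
    fin_cases x <;> fin_cases y <;> simp [Matrix.trace]
  have h10 : ∀ x y : Fin 2, noisyTeleport p (Matrix.single 1 0 1) x y =
      if 1 = x ∧ 0 = y then (p : ℂ) else 0 := by
    intro x y
    rw [noisyTeleport_apply]
    fin_cases x <;> fin_cases y <;> simp [Matrix.trace]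
  rw [hsum]
  simp_rw [h00, h11, h01, h10, Fintype.prod_ite_zero, forall_and, Finset.prod_const,
    Finset.card_univ, Fintype.card_fin]
  simp only [Matrix.add_apply, Matrix.smul_apply, Matrix.diagonal_apply, Matrix.single_apply,
    teleportedWeight, funext_iff, smul_eq_mul, ← Complex.ofReal_prod]
  push_cast
  split_ifs <;> ring

lemma isTP_noisyTeleport (p : ℝ) : IsTP (noisyTeleport p) := by
  intro X
  rw [noisyTeleport_apply]
  simp
  ring

/-- The party `q` excludes `n = 0`, where the two strings coincide and the trace is `2`. -/
lemma trace_teleportedGHZ (p : ℝ) {n : ℕ} (q : Fin n) : (teleportedGHZ p n).trace = 1 := by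
  have h : (fun _ => 0 : Fin n → Fin 2) ≠ fun _ => 1 := fun e => by simpa using congrFun e q
  rw [teleportedGHZ, isTP_tensorMap (fun _ => isTP_noisyTeleport p)]
  simp only [Matrix.trace, Matrix.diag, ghz_apply]
  simp only [mul_add, Finset.sum_add_distrib, mul_ite, mul_one, mul_zero, Finset.sum_ite_eq',
    Finset.mem_univ, if_true, h, h.symm, if_false]
  norm_num

/-- The teleported GHZ state has positive partial transpose for each single party as soon as
`p ^ n ≤ (1 - p) / 2 * ((1 + p) / 2) ^ (n - 1)`. -/
lemma isPPTState_teleportedGHZ {p : ℝ} (hp0 : 0 ≤ p) (hp1 : p ≤ 1) {m : ℕ}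
    (h : p ^ (m + 1) ≤ (1 - p) / 2 * ((1 + p) / 2) ^ m) :
    IsPPTState 0 (teleportedGHZ p (m + 1)) := by
  have ha : 0 ≤ (1 + p) / 2 := by linarith
  have hb : 0 ≤ (1 - p) / 2 := by linarith
  have hc : 0 ≤ p ^ (m + 1) / 2 := by positivity
  have hd : ∀ s : Fin (m + 1) → Fin 2, 0 ≤ teleportedWeight p s := by
    intro s
    refine div_nonneg (add_nonneg ?_ ?_) zero_le_two <;>
      exact Finset.prod_nonneg fun i _ => by split_ifs <;> assumption
  have hpa : p ^ (m + 1) ≤ ((1 + p) / 2) ^ (m + 1) := pow_le_pow_left₀ hp0 (by linarith) _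
  have hbn : 0 ≤ ((1 - p) / 2) ^ (m + 1) := pow_nonneg hb _
  have hbm : 0 ≤ (1 + p) / 2 * ((1 - p) / 2) ^ m := mul_nonneg ha (pow_nonneg hb _)
  refine ⟨?_, ?_, trace_teleportedGHZ p 0⟩
  · rw [teleportedGHZ_eq]
    -- Both corners have weight at least `((1 + p) / 2) ^ (m + 1) / 2`, so `hpa` suffices.
    refine posSemidef_diagonal_add_single hd (fun e => by simpa using congrFun e 0) hc ?_ ?_ <;>
      · simp only [teleportedWeight]
        simp [-Finset.prod_div_distrib]
        linarith
  · rw [teleportedGHZ_eq, partialTranspose_add, partialTranspose_smul, partialTranspose_add,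
      partialTranspose_diagonal, partialTranspose_single, partialTranspose_single]
    -- Now the corners are `10…0` and `01…1`; splitting off party `0` exhibits the product in `h` as
    -- one summand of their weights.
    refine posSemidef_diagonal_add_single hd (fun e => by simpa using congrFun e 0) hc ?_ ?_ <;>
      · simp only [teleportedWeight, Fin.prod_univ_succ]
        simp [-Finset.prod_div_distrib]
        linarith

/-- The ratio `p / ((1 + p) / 2)` is below `1` exactly because `p < 1`, so its powers fall below `(1
- p) / 2`; the extra factor `p` on the left is discarded. -/
lemma exists_pow_succ_le {p : ℝ} (hp0 : 0 ≤ p) (hp1 : p < 1) :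
    ∃ N : ℕ, ∀ m ≥ N, p ^ (m + 1) ≤ (1 - p) / 2 * ((1 + p) / 2) ^ m := by
  have ha : 0 < (1 + p) / 2 := by linarith
  have hx0 : 0 ≤ p / ((1 + p) / 2) := by positivity
  have hx1 : p / ((1 + p) / 2) < 1 := (div_lt_one ha).mpr (by linarith)
  obtain ⟨N, hN⟩ := exists_pow_lt_of_lt_one (show 0 < (1 - p) / 2 by linarith) hx1
  refine ⟨N, fun m hm => ?_⟩
  have h1 : (p / ((1 + p) / 2)) ^ m ≤ (1 - p) / 2 :=
    (pow_le_pow_of_le_one hx0 hx1.le hm).trans hN.le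
  rw [div_pow, div_le_iff₀ (pow_pos ha m)] at h1
  exact (pow_le_pow_of_le_one hp0 hp1.le (Nat.le_succ m)).trans h1

end

end GHZNetwork

theorem theorem2 (p : ℝ) (hp0 : 0 ≤ p) (hp1 : p < 1) :
    ∃ n₀ : ℕ, ∀ n ≥ n₀, ¬ GHZNetwork.GHZDistillable n (GHZNetwork.teleportedGHZ p n) := by
  obtain ⟨N, hN⟩ := GHZNetwork.exists_pow_succ_le hp0 hp1
  -- The shift by `2` provides a party `1` besides the transposed party `0`.
  refine ⟨N + 2, fun n hn => ?_⟩
  obtain ⟨m, rfl⟩ : ∃ m, n = m + 2 := ⟨n - 2, by omega⟩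
  exact (GHZNetwork.isPPTState_teleportedGHZ hp0 hp1.le (m := m + 1)
    (hN (m + 1) (by omega))).not_ghzDistillable (r := 1) (by simp)
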